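/- For a function $p:\mathbb{N}\to[0,1]$, let $\mathcal{G}(n,p)$ denote the Erdős–Rényi random graph on $n$ vertices in which each of the $\binom n2$ possible edges is present independently with probability $p=p(n)$. Let $L=D-A$ be the Laplacian matrix of a realization of this graph, where $D$ is its diagonal degree matrix and $A$ its adjacency matrix, and let $0=\lambda_1(L)\le\lambda_2(L)\le\cdots\le\lambda_n(L)$ be the eigenvalues of $L$, counted with multiplicity. Suppose that $$\limsup_{n\to\infty}\frac{\ln n}{n\,p(n)}<1,$$ where for $n\ge 2$ the quotient is $+\infty$ if $p(n)=0$. Then there is a constant $\gamma>0$, which may depend on the function $p$ but not on $n$, such that the algebraic connectivity satisfies $\lambda_2(L)\ge\gamma\,n\,p(n)$ asymptotically almost surely, that is, $$\lim_{n\to\infty}\Pr\bigl[\lambda_2(L)\ge\gamma\,n\,p(n)\bigr]=1.$$ -/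

import Mathlib

open Filter Topology MeasureTheory

open Classical in
/-- The algebraic connectivity `λ₂(L)` of a finite simple graph `G`: the second smallest eigenvalue,
counted with multiplicity, of its Laplacian matrix `L = D - A`. Mathlib lists the eigenvalues of a
Hermitian matrix in decreasing order with indices `0, …, |V| - 1`, so the second smallest one has
index `|V| - 2`. On fewer than two vertices there is no second eigenvalue and the value is `0`. -/
noncomputable def algebraicConnectivity {V : Type*} [Fintype V] (G : SimpleGraph V) : ℝ :=
  if h : 2 ≤ Fintype.card V then
    (G.isHermitian_lapMatrix ℝ).eigenvalues₀ ⟨Fintype.card V - 2, by omega⟩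
  else 0

/-- For a sequence of edge probabilities `p`, the random graph `G(n, p n)` on the vertex set `Fin n`
has the property `P` asymptotically almost surely: the probability of the set of graphs with that
property tends to `1` as `n → ∞`. -/
def AsymptoticallyAlmostSurely (p : ℕ → unitInterval)
    (P : ∀ n : ℕ, SimpleGraph (Fin n) → Prop) : Prop :=
  Tendsto (fun n : ℕ => SimpleGraph.binomialRandom (Fin n) (p n) {G | P n G}) atTop (𝓝 1)


/-!
By the discrete Cheeger inequality, a graph with maximum degree at most `D` in which at least
`h * |S|` edges leave every set `S` of at most half of the vertices satisfies `h² / (2 D) ≤ λ₂`.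
For this, a vector with zero sum is shifted to have median zero and split into its positive and
negative parts; each part is supported on at most half of the vertices, so that integrating the
expansion of its level sets bounds its square norm.

In `G(n, p)`, Chernoff bounds and a union bound show that asymptotically almost surely all degrees
are at most `4 n p` and all sets `S` expand with `h = ε n p`. The expansion of a set with
`|S| = k ≤ a n` fails with probability at most `n ^ (-(1 + a) k)`, and the sum over all such sets
tends to `0`; this is where `ln n ≤ (1 - 4 a) n p` is needed. A larger set fails with probability
at most `n ^ (-a n / 8)`, which beats the number `2 ^ n` of sets.
-/
section Darts

variable {V : Type*} [Fintype V] (G : SimpleGraph V) [DecidableRel G.Adj]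

theorem sum_dart_eq_sum_sum_ite {M : Type*} [AddCommMonoid M] (w : V → V → M) :
    ∑ d : G.Dart, w d.fst d.snd = ∑ i, ∑ j, if G.Adj i j then w i j else 0 := by
  rw [← Fintype.sum_prod_type', ← Finset.sum_filter]
  exact Finset.sum_bij (fun d _ => d.toProd) (fun d _ => by simp)
    (fun _ _ _ _ h => SimpleGraph.Dart.ext _ _ h)
    (fun x hx => ⟨⟨x, (Finset.mem_filter.1 hx).2⟩, Finset.mem_univ _, rfl⟩) fun _ _ => rfl

theorem sum_dart_fst {M : Type*} [AddCommMonoid M] (f : V → M) :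
    ∑ d : G.Dart, f d.fst = ∑ v, G.degree v • f v := by
  rw [sum_dart_eq_sum_sum_ite G fun i _ => f i]
  refine Finset.sum_congr rfl fun i _ => ?_
  rw [← Finset.sum_filter, Finset.sum_const, ← SimpleGraph.neighborFinset_eq_filter,
    SimpleGraph.card_neighborFinset_eq_degree]

theorem sum_dart_symm {M : Type*} [AddCommMonoid M] (w : V → V → M) :
    ∑ d : G.Dart, w d.snd d.fst = ∑ d : G.Dart, w d.fst d.snd :=
  Equiv.sum_comp (SimpleGraph.Dart.symm_involutive (G := G)).toPerm fun d => w d.fst d.snd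

theorem sum_dart_abs_indicator_sub [DecidableEq V] (S : Finset V) :
    ∑ d : G.Dart, |(if d.fst ∈ S then (1 : ℝ) else 0) - (if d.snd ∈ S then 1 else 0)| =
      2 * (G.interedges S Sᶜ).card := by
  set leaves : V → V → ℝ := fun i j => if i ∈ S ∧ j ∉ S then 1 else 0
  have hleaves : ∑ d : G.Dart, leaves d.fst d.snd = (G.interedges S Sᶜ).card := by
    rw [sum_dart_eq_sum_sum_ite, ← Fintype.sum_prod_type']
    simp only [leaves, ← ite_and, Finset.sum_boole]
    congr 2
    ext x
    simp only [Finset.mem_filter, Finset.mem_univ, SimpleGraph.mem_interedges_iff,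
      Finset.mem_compl]
    tauto
  calc _ = ∑ d : G.Dart, (leaves d.fst d.snd + leaves d.snd d.fst) := by
        refine Finset.sum_congr rfl fun d _ => ?_
        by_cases hi : d.fst ∈ S <;> by_cases hj : d.snd ∈ S <;> simp [leaves, hi, hj]
    _ = 2 * (G.interedges S Sᶜ).card := by
        rw [Finset.sum_add_distrib, sum_dart_symm, hleaves, two_mul]

theorem dotProduct_lapMatrix_mulVec [DecidableEq V] (x : V → ℝ) :
    x ⬝ᵥ (G.lapMatrix ℝ).mulVec x = (∑ d : G.Dart, (x d.fst - x d.snd) ^ 2) / 2 := by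
  rw [← Matrix.toLinearMap₂'_apply', SimpleGraph.lapMatrix_toLinearMap₂',
    sum_dart_eq_sum_sum_ite G fun i j => (x i - x j) ^ 2]

end Darts

section Layers

theorem abs_indicator_Iio_sub_indicator_Iio (a b : ℝ) :
    (fun t => |(if t < a then (1 : ℝ) else 0) - (if t < b then 1 else 0)|) =
      (Set.Ico (min a b) (max a b)).indicator 1 := by
  ext t
  simp only [Set.indicator, Set.mem_Ico, Pi.one_apply]
  grind

theorem integrable_abs_indicator_Iio_sub (a b : ℝ) :
    Integrable fun t => |(if t < a then (1 : ℝ) else 0) - (if t < b then 1 else 0)| := by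
  rw [abs_indicator_Iio_sub_indicator_Iio]
  exact (integrable_indicator_iff measurableSet_Ico).2 (integrableOn_const (by simp))

theorem integral_abs_indicator_Iio_sub (a b : ℝ) :
    ∫ t, |(if t < a then (1 : ℝ) else 0) - (if t < b then 1 else 0)| = |a - b| := by
  rw [abs_indicator_Iio_sub_indicator_Iio, integral_indicator_one measurableSet_Ico,
    Real.volume_real_Ico_of_le min_le_max, max_sub_min_eq_abs']

end Layers

section Median

theorem exists_median {V α : Type*} [Fintype V] [Nonempty V] [LinearOrder α] (f : V → α) :
    ∃ m, 2 * (Finset.univ.filter fun i => m < f i).card ≤ Fintype.card V ∧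
      2 * (Finset.univ.filter fun i => f i < m).card ≤ Fintype.card V := by
  classical
  set T := (Finset.univ : Finset V).filter
    fun k => 2 * (Finset.univ.filter fun i => f k < f i).card ≤ Fintype.card V
  obtain ⟨top, -, htop⟩ := Finset.univ.exists_max_image f Finset.univ_nonempty
  have hT : T.Nonempty :=
    ⟨top, by simp [T, Finset.filter_false_of_mem fun i hi => (htop i hi).not_gt]⟩
  obtain ⟨k, hk, hmin⟩ := T.exists_min_image f hT
  refine ⟨f k, (Finset.mem_filter.1 hk).2, ?_⟩
  rcases (Finset.univ.filter fun i => f i < f k).eq_empty_or_nonempty with hempty | hne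
  · simp [hempty]
  obtain ⟨l, hl, hmax⟩ := Finset.exists_max_image _ f hne
  have habove : Fintype.card V < 2 * (Finset.univ.filter fun i => f l < f i).card := by
    by_contra! hle
    exact (hmin l (by simp [T, hle])).not_gt (by simpa using hl)
  have hbelow : (Finset.univ.filter fun i => f i < f k) ⊆
      (Finset.univ.filter fun i => f l < f i)ᶜ := fun i hi => by simpa using hmax i hi
  have := Finset.card_le_card hbelow
  rw [Finset.card_compl] at this
  omega

end Median

/-- The graph `G` has edge expansion at least `h`: at least `h * |S|` edges leave each set `S` of at
most half of the vertices. It is the bound `h ≤ min e(S, Sᶜ) / |S|` on the isoperimetric number,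
multiplied out so that the empty set is harmless. -/
def HasEdgeExpansion {V : Type*} [Fintype V] [DecidableEq V] (G : SimpleGraph V)
    [DecidableRel G.Adj] (h : ℝ) : Prop :=
  ∀ S : Finset V, 2 * S.card ≤ Fintype.card V → h * S.card ≤ (G.interedges S Sᶜ).card

section Cheeger

variable {V : Type*} [Fintype V] [DecidableEq V] {G : SimpleGraph V} [DecidableRel G.Adj] {h D : ℝ}

namespace HasEdgeExpansion

theorem two_mul_sum_le_sum_dart_abs_sub (hG : HasEdgeExpansion G h) {φ : V → ℝ} (hφ : 0 ≤ φ)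
    (hsupp : 2 * (Finset.univ.filter fun i => 0 < φ i).card ≤ Fintype.card V) :
    2 * h * ∑ i, φ i ≤ ∑ d : G.Dart, |φ d.fst - φ d.snd| := by
  set χ : ℝ → ℝ → ℝ := fun a t => if t < a then 1 else 0
  have hlayer (t : ℝ) :
      2 * h * ∑ i, |χ (φ i) t - χ 0 t| ≤ ∑ d : G.Dart, |χ (φ d.fst) t - χ (φ d.snd) t| := by
    rcases lt_or_ge t 0 with ht | ht
    · have hone (i : V) : χ (φ i) t = 1 := if_pos (ht.trans_le (hφ i))
      simp [hone, χ, ht]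
    set S := Finset.univ.filter fun i => t < φ i
    have hS : S ⊆ Finset.univ.filter fun i => 0 < φ i :=
      Finset.monotone_filter_right _ fun i _ hi => ht.trans_lt hi
    have hcut := hG S ((Nat.mul_le_mul_left 2 (Finset.card_le_card hS)).trans hsupp)
    have hsum : ∑ i, |χ (φ i) t - χ 0 t| = S.card := by
      simp [χ, ht.not_gt, S, apply_ite abs]
    have hdart : ∑ d : G.Dart, |χ (φ d.fst) t - χ (φ d.snd) t| = 2 * (G.interedges S Sᶜ).card := by
      rw [← sum_dart_abs_indicator_sub]
      simp only [χ, S, Finset.mem_filter, Finset.mem_univ, true_and]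
    rw [hsum, hdart]
    linarith
  calc 2 * h * ∑ i, φ i = ∫ t, 2 * h * ∑ i, |χ (φ i) t - χ 0 t| := by
        rw [integral_const_mul,
          integral_finsetSum _ fun i _ => integrable_abs_indicator_Iio_sub _ _]
        simp only [integral_abs_indicator_Iio_sub, sub_zero, abs_of_nonneg (hφ _)]
    _ ≤ ∫ t, ∑ d : G.Dart, |χ (φ d.fst) t - χ (φ d.snd) t| :=
        integral_mono
          ((integrable_finsetSum _ fun i _ => integrable_abs_indicator_Iio_sub _ _).const_mul _)
          (integrable_finsetSum _ fun d _ => integrable_abs_indicator_Iio_sub _ _) hlayer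
    _ = ∑ d : G.Dart, |φ d.fst - φ d.snd| := by
        rw [integral_finsetSum _ fun d _ => integrable_abs_indicator_Iio_sub _ _]
        simp only [integral_abs_indicator_Iio_sub]

end HasEdgeExpansion

omit [DecidableEq V] in
theorem sum_dart_add_sq_le (hD : ∀ v, (G.degree v : ℝ) ≤ D) (g : V → ℝ) :
    ∑ d : G.Dart, (g d.fst + g d.snd) ^ 2 ≤ 4 * (D * ∑ i, g i ^ 2) := by
  have hfst : ∑ d : G.Dart, g d.fst ^ 2 ≤ D * ∑ i, g i ^ 2 := by
    rw [sum_dart_fst G fun i => g i ^ 2, Finset.mul_sum]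
    simp only [nsmul_eq_mul]
    gcongr with v
    exact hD v
  calc ∑ d : G.Dart, (g d.fst + g d.snd) ^ 2
      ≤ ∑ d : G.Dart, 2 * (g d.fst ^ 2 + g d.snd ^ 2) :=
        Finset.sum_le_sum fun d _ => add_sq_le
    _ = 4 * ∑ d : G.Dart, g d.fst ^ 2 := by
        rw [← Finset.mul_sum, Finset.sum_add_distrib, sum_dart_symm G fun i _ => g i ^ 2]
        ring
    _ ≤ 4 * (D * ∑ i, g i ^ 2) := by gcongr

namespace HasEdgeExpansion

theorem sq_mul_sum_sq_le_of_card_support_le [Nonempty V] (hG : HasEdgeExpansion G h) (hh : 0 ≤ h)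
    (hD : ∀ v, (G.degree v : ℝ) ≤ D) {g : V → ℝ}
    (hsupp : 2 * (Finset.univ.filter fun i => g i ≠ 0).card ≤ Fintype.card V) :
    h ^ 2 * ∑ i, g i ^ 2 ≤ D * ∑ d : G.Dart, (g d.fst - g d.snd) ^ 2 := by
  set X := ∑ i, g i ^ 2
  set E := ∑ d : G.Dart, (g d.fst - g d.snd) ^ 2
  have hE : 0 ≤ E := Finset.sum_nonneg fun d _ => sq_nonneg _
  have hcoarea : 2 * h * X ≤ ∑ d : G.Dart, |g d.fst - g d.snd| * |g d.fst + g d.snd| := by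
    refine (hG.two_mul_sum_le_sum_dart_abs_sub (φ := fun i => g i ^ 2) (fun i => sq_nonneg _)
      (by simpa only [sq_pos_iff] using hsupp)).trans_eq (Finset.sum_congr rfl fun d _ => ?_)
    rw [← abs_mul, sq_sub_sq, mul_comm]
  have hcauchy : (∑ d : G.Dart, |g d.fst - g d.snd| * |g d.fst + g d.snd|) ^ 2
      ≤ E * ∑ d : G.Dart, (g d.fst + g d.snd) ^ 2 := by
    simpa only [sq_abs] using Finset.sum_mul_sq_le_sq_mul_sq Finset.univ
      (fun d : G.Dart => |g d.fst - g d.snd|) fun d => |g d.fst + g d.snd|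
  have hX : 0 ≤ X := Finset.sum_nonneg fun i _ => sq_nonneg _
  rcases hX.eq_or_lt with hX | hX
  · rw [← hX, mul_zero]
    exact mul_nonneg ((Nat.cast_nonneg _).trans (hD (Classical.arbitrary V))) hE
  · have hsq : (2 * h * X) ^ 2 ≤ E * (4 * (D * X)) :=
      (pow_le_pow_left₀ (by positivity) hcoarea 2).trans
        (hcauchy.trans (mul_le_mul_of_nonneg_left (sum_dart_add_sq_le hD g) hE))
    refine le_of_mul_le_mul_right ?_ (mul_pos four_pos hX)
    linarith

end HasEdgeExpansion

theorem posPart_mul_negPart_eq_zero (a : ℝ) : a⁺ * a⁻ = 0 := by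
  rcases le_total 0 a with ha | ha
  · rw [negPart_of_nonneg ha, mul_zero]
  · rw [posPart_of_nonpos ha, zero_mul]

theorem sq_posPart_sub_add_sq_negPart_sub_le (a b : ℝ) :
    (a⁺ - b⁺) ^ 2 + (a⁻ - b⁻) ^ 2 ≤ (a - b) ^ 2 := by
  nth_rw 3 [← posPart_sub_negPart a, ← posPart_sub_negPart b]
  have ha := posPart_mul_negPart_eq_zero a
  have hb := posPart_mul_negPart_eq_zero b
  nlinarith [mul_nonneg (posPart_nonneg a) (negPart_nonneg b),
    mul_nonneg (posPart_nonneg b) (negPart_nonneg a)]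

theorem sq_posPart_add_sq_negPart (a : ℝ) : a⁺ ^ 2 + a⁻ ^ 2 = a ^ 2 := by
  nth_rw 3 [← posPart_sub_negPart a]
  linear_combination 2 * posPart_mul_negPart_eq_zero a

theorem sum_sq_le_sum_sub_sq {ι : Type*} [Fintype ι] {f : ι → ℝ} (hf : ∑ i, f i = 0) (m : ℝ) :
    ∑ i, f i ^ 2 ≤ ∑ i, (f i - m) ^ 2 := by
  have : ∑ i, (f i - m) ^ 2 = ∑ i, f i ^ 2 + Fintype.card ι * m ^ 2 := by
    simp [sub_sq, Finset.sum_add_distrib, ← Finset.mul_sum, ← Finset.sum_mul, hf]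
  rw [this]
  exact le_add_of_nonneg_right (by positivity)

namespace HasEdgeExpansion

theorem sq_mul_sum_sq_le_of_median_zero [Nonempty V] (hG : HasEdgeExpansion G h) (hh : 0 ≤ h)
    (hD : ∀ v, (G.degree v : ℝ) ≤ D) {g : V → ℝ}
    (hpos : 2 * (Finset.univ.filter fun i => 0 < g i).card ≤ Fintype.card V)
    (hneg : 2 * (Finset.univ.filter fun i => g i < 0).card ≤ Fintype.card V) :
    h ^ 2 * ∑ i, g i ^ 2 ≤ D * ∑ d : G.Dart, (g d.fst - g d.snd) ^ 2 := by
  have hD0 : 0 ≤ D := (Nat.cast_nonneg _).trans (hD (Classical.arbitrary V))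
  have hp := hG.sq_mul_sum_sq_le_of_card_support_le hh hD (g := fun i => (g i)⁺)
    (by simpa using hpos)
  have hn := hG.sq_mul_sum_sq_le_of_card_support_le hh hD (g := fun i => (g i)⁻)
    (by simpa using hneg)
  calc h ^ 2 * ∑ i, g i ^ 2 = h ^ 2 * ∑ i, (g i)⁺ ^ 2 + h ^ 2 * ∑ i, (g i)⁻ ^ 2 := by
        simp only [← mul_add, ← Finset.sum_add_distrib, sq_posPart_add_sq_negPart]
    _ ≤ D * ∑ d : G.Dart, ((g d.fst)⁺ - (g d.snd)⁺) ^ 2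
          + D * ∑ d : G.Dart, ((g d.fst)⁻ - (g d.snd)⁻) ^ 2 := add_le_add hp hn
    _ ≤ D * ∑ d : G.Dart, (g d.fst - g d.snd) ^ 2 := by
        rw [← mul_add, ← Finset.sum_add_distrib]
        gcongr
        exact sq_posPart_sub_add_sq_negPart_sub_le _ _

theorem sq_mul_sum_sq_le_of_sum_eq_zero [Nonempty V] (hG : HasEdgeExpansion G h) (hh : 0 ≤ h)
    (hD : ∀ v, (G.degree v : ℝ) ≤ D) {f : V → ℝ} (hf : ∑ i, f i = 0) :
    h ^ 2 * ∑ i, f i ^ 2 ≤ D * ∑ d : G.Dart, (f d.fst - f d.snd) ^ 2 := by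
  obtain ⟨m, habove, hbelow⟩ := exists_median f
  calc h ^ 2 * ∑ i, f i ^ 2 ≤ h ^ 2 * ∑ i, (f i - m) ^ 2 := by
        gcongr h ^ 2 * ?_
        exact sum_sq_le_sum_sub_sq hf m
    _ ≤ D * ∑ d : G.Dart, (f d.fst - f d.snd) ^ 2 := by
        simpa using hG.sq_mul_sum_sq_le_of_median_zero hh hD (g := fun i => f i - m)
          (by simpa using habove) (by simpa using hbelow)

end HasEdgeExpansion

end Cheeger

section MinMax

open scoped InnerProductSpace

variable {𝕜 E : Type*} [RCLike 𝕜] [NormedAddCommGroup E] [InnerProductSpace 𝕜 E]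
  [FiniteDimensional 𝕜 E] {T : E →ₗ[𝕜] E} {n : ℕ}

theorem re_inner_apply_self_eq_sum (hT : T.IsSymmetric) (hn : Module.finrank 𝕜 E = n) (x : E) :
    RCLike.re ⟪x, T x⟫_𝕜 = ∑ i, hT.eigenvalues hn i * ‖⟪hT.eigenvectorBasis hn i, x⟫_𝕜‖ ^ 2 := by
  rw [← (hT.eigenvectorBasis hn).sum_inner_mul_inner x (T x), map_sum]
  refine Finset.sum_congr rfl fun i _ => ?_
  rw [← hT (hT.eigenvectorBasis hn i) x, hT.apply_eigenvectorBasis, inner_smul_left,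
    RCLike.conj_ofReal, mul_left_comm, ← inner_conj_symm, RCLike.conj_mul, ← RCLike.ofReal_pow,
    ← RCLike.ofReal_mul, RCLike.ofReal_re]

theorem le_eigenvalues_of_lt_finrank (hT : T.IsSymmetric) (hn : Module.finrank 𝕜 E = n)
    {k : Fin n} {W : Submodule 𝕜 E} (hW : k < Module.finrank 𝕜 W) {μ : ℝ}
    (hμ : ∀ x ∈ W, μ * ‖x‖ ^ 2 ≤ RCLike.re ⟪x, T x⟫_𝕜) :
    μ ≤ hT.eigenvalues hn k := by
  set b := hT.eigenvectorBasis hn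
  set coords : W →ₗ[𝕜] Set.Iio k → 𝕜 :=
    LinearMap.pi fun i => (innerₛₗ 𝕜 (b i)).comp W.subtype
  obtain ⟨⟨x, hxW⟩, hx, hx0⟩ := (Submodule.ne_bot_iff _).1
    (LinearMap.ker_ne_bot_of_finrank_lt (f := coords) (by simpa using hW))
  have hcoords (i : Fin n) (hi : i < k) : ⟪b i, x⟫_𝕜 = 0 := congrFun hx ⟨i, hi⟩
  have hnorm : 0 < ‖x‖ ^ 2 := pow_pos (norm_pos_iff.2 fun h => hx0 (Subtype.ext h)) 2
  refine le_of_mul_le_mul_right ((hμ x hxW).trans ?_) hnorm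
  rw [re_inner_apply_self_eq_sum hT hn, ← b.sum_sq_norm_inner_right, Finset.mul_sum]
  refine Finset.sum_le_sum fun i _ => ?_
  rcases lt_or_ge i k with hi | hi
  · simp [hcoords i hi, b]
  · gcongr
    exact hT.eigenvalues_antitone hn hi

end MinMax

section AlgebraicConnectivity

variable {V : Type*} [Fintype V] [DecidableEq V]

theorem le_eigenvalues₀_card_sub_two {A : Matrix V V ℝ} (hA : A.IsHermitian)
    (hV : 2 ≤ Fintype.card V) {μ : ℝ}
    (hμ : ∀ x : V → ℝ, ∑ i, x i = 0 → μ * ∑ i, x i ^ 2 ≤ x ⬝ᵥ A.mulVec x) :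
    μ ≤ hA.eigenvalues₀ ⟨Fintype.card V - 2, by omega⟩ := by
  set total : EuclideanSpace ℝ V →ₗ[ℝ] ℝ := ∑ i, (EuclideanSpace.proj i).toLinearMap
  have hker : Fintype.card V - 2 < Module.finrank ℝ total.ker := by
    have hrange := total.range.finrank_le
    have hrank := total.finrank_range_add_finrank_ker
    rw [finrank_euclideanSpace] at hrank
    rw [Module.finrank_self] at hrange
    omega
  refine le_eigenvalues_of_lt_finrank (Matrix.isSymmetric_toEuclideanLin_iff.2 hA)
    finrank_euclideanSpace hker fun x hx => ?_
  convert hμ x.ofLp (by simpa [total] using hx) using 2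
  · exact EuclideanSpace.real_norm_sq_eq x
  · simp [PiLp.inner_apply, dotProduct, mul_comm]

variable {G : SimpleGraph V} [DecidableRel G.Adj]

theorem le_algebraicConnectivity_of_forall_sum_eq_zero (hV : 2 ≤ Fintype.card V) {μ : ℝ}
    (hμ : ∀ x : V → ℝ, ∑ i, x i = 0 → μ * ∑ i, x i ^ 2 ≤ x ⬝ᵥ (G.lapMatrix ℝ).mulVec x) :
    μ ≤ algebraicConnectivity G := by
  rw [algebraicConnectivity, dif_pos hV]
  convert le_eigenvalues₀_card_sub_two (G.isHermitian_lapMatrix ℝ) hV hμ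

theorem HasEdgeExpansion.le_algebraicConnectivity {h D : ℝ} (hG : HasEdgeExpansion G h)
    (hV : 2 ≤ Fintype.card V) (hh : 0 ≤ h) (hD : 0 < D) (hdeg : ∀ v, (G.degree v : ℝ) ≤ D) :
    h ^ 2 / (2 * D) ≤ algebraicConnectivity G := by
  have : Nonempty V := Fintype.card_pos_iff.1 (by omega)
  refine le_algebraicConnectivity_of_forall_sum_eq_zero hV fun x hx => ?_
  have hcheeger := hG.sq_mul_sum_sq_le_of_sum_eq_zero hh hdeg hx
  rw [dotProduct_lapMatrix_mulVec, div_mul_eq_mul_div, div_le_div_iff₀ (by positivity) two_pos]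
  linarith

end AlgebraicConnectivity

section Bernoulli

open ProbabilityTheory unitInterval

open scoped Classical in
theorem mgf_indicator_dirac_add_dirac (p : I) (t : ℝ) :
    mgf (fun q : Prop => if q then (1 : ℝ) else 0)
      (toNNReal p • Measure.dirac True + toNNReal (σ p) • Measure.dirac False) t =
      1 - p + p * Real.exp t := by
  rw [mgf, integral_add_measure .of_finite .of_finite, integral_smul_nnreal_measure,
    integral_smul_nnreal_measure, integral_dirac, integral_dirac]
  simp [NNReal.smul_def, add_comm]

open scoped Classical in
theorem mgf_card_filter_mem_setBernoulli {ι : Type*} {u : Set ι} {F : Finset ι}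
    (hF : (F : Set ι) ⊆ u) (p : I) (t : ℝ) :
    mgf (fun s : Set ι => ((F.filter (· ∈ s)).card : ℝ)) (setBernoulli u p) t =
      (1 - p + p * Real.exp t) ^ F.card := by
  set indicator : Prop → ℝ := fun q => if q then 1 else 0
  set ν : ι → Measure Prop := fun i =>
    toNNReal p • Measure.dirac (i ∈ u) + toNNReal (σ p) • Measure.dirac False
  have hmeas (i : ι) : Measurable fun ω : ι → Prop => indicator (ω i) :=
    (Measurable.of_discrete (f := indicator)).comp (measurable_pi_apply i)
  have hmeas' (i : ι) : Measurable fun s : Set ι => indicator (i ∈ s) :=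
    (Measurable.of_discrete (f := indicator)).comp (measurable_set_mem i)
  have hcount : (fun s : Set ι => ((F.filter (· ∈ s)).card : ℝ)) =
      fun s => ∑ i ∈ F, indicator (i ∈ s) := by
    simp [indicator]
  have hmgf (i : ι) (hi : i ∈ F) :
      mgf (fun ω : ι → Prop => indicator (ω i)) (Measure.infinitePi ν) t =
        1 - p + p * Real.exp t := by
    have hmap := mgf_map (measurable_pi_apply i).aemeasurable (μ := Measure.infinitePi ν)
      (X := indicator) (t := t) Measurable.of_discrete.aestronglyMeasurable
    rw [← Function.comp_def indicator, ← hmap, Measure.infinitePi_map_eval]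
    simpa only [ν, eq_true (hF hi)] using mgf_indicator_dirac_add_dirac p t
  have hindep : iIndepFun (fun i (ω : ι → Prop) => indicator (ω i)) (Measure.infinitePi ν) :=
    iIndepFun_infinitePi fun _ => .of_discrete
  rw [hcount, setBernoulli_eq_map, mgf_map (by fun_prop)
      ((Finset.measurable_sum F fun i _ => hmeas' i).const_mul t).exp.aestronglyMeasurable,
    ← Finset.prod_const, ← Finset.prod_congr rfl hmgf, ← hindep.mgf_sum hmeas F]
  congr 1
  ext ω
  simp

end Bernoulli

section CutPairs

variable {V : Type*} [Fintype V] [DecidableEq V]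

/-- The pairs with exactly one element in `S`, that is, the potential edges leaving `S`. -/
def cutPairs (S : Finset V) : Finset (Sym2 V) :=
  (S ×ˢ Sᶜ).image fun x => s(x.1, x.2)

theorem injOn_sym2_mk_prod_compl (S : Finset V) :
    Set.InjOn (fun x : V × V => s(x.1, x.2)) (S ×ˢ Sᶜ : Finset (V × V)) := by
  rintro ⟨a, b⟩ hab ⟨c, d⟩ hcd heq
  simp only [Finset.coe_product, Set.mem_prod, Finset.mem_coe, Finset.mem_compl] at hab hcd
  rcases Sym2.eq_iff.1 heq with ⟨rfl, rfl⟩ | ⟨rfl, rfl⟩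
  · rfl
  · exact absurd hab.1 hcd.2

theorem card_cutPairs (S : Finset V) : (cutPairs S).card = S.card * Sᶜ.card := by
  rw [cutPairs, Finset.card_image_of_injOn (injOn_sym2_mk_prod_compl S), Finset.card_product]

theorem cutPairs_subset_compl_diagSet (S : Finset V) :
    (cutPairs S : Set (Sym2 V)) ⊆ Sym2.diagSetᶜ := by
  intro e he
  simp only [cutPairs, Finset.coe_image, Set.mem_image, Finset.mem_coe, Finset.mem_product,
    Finset.mem_compl] at he
  obtain ⟨⟨a, b⟩, ⟨ha, hb⟩, rfl⟩ := he
  simpa using fun h : a = b => hb (h ▸ ha)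

theorem card_interedges_compl_fromEdgeSet (S : Finset V) (s : Set (Sym2 V))
    [DecidablePred (· ∈ s)] [DecidableRel (SimpleGraph.fromEdgeSet s).Adj] :
    ((SimpleGraph.fromEdgeSet s).interedges S Sᶜ).card = ((cutPairs S).filter (· ∈ s)).card := by
  rw [cutPairs, Finset.filter_image, Finset.card_image_of_injOn
    ((injOn_sym2_mk_prod_compl S).mono (Finset.coe_subset.2 (Finset.filter_subset _ _)))]
  congr 1
  ext ⟨a, b⟩
  simp only [SimpleGraph.mem_interedges_iff, SimpleGraph.fromEdgeSet_adj, Finset.mem_filter,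
    Finset.mem_product, Finset.mem_compl]
  grind

end CutPairs

section RandomGraph

open SimpleGraph ProbabilityTheory

instance {V : Type*} [Countable V] : MeasurableSingletonClass (SimpleGraph V) where
  measurableSet_singleton G := by
    have hpre : {G} = edgeSet ⁻¹' {G.edgeSet} := by
      ext H
      simp
    rw [hpre]
    exact measurable_edgeSet (measurableSet_singleton _)

variable {V : Type*} [Fintype V] [DecidableEq V] (p : unitInterval) (S : Finset V) {t : ℝ}

open scoped Classical in
theorem mgf_card_interedges_compl :
    mgf (fun G : SimpleGraph V => ((G.interedges S Sᶜ).card : ℝ)) (binomialRandom V p) t =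
      (1 - p + p * Real.exp t) ^ (S.card * Sᶜ.card) := by
  rw [binomialRandom_eq_map, mgf_map measurable_fromEdgeSet.aemeasurable
    Measurable.of_discrete.aestronglyMeasurable, ← card_cutPairs,
    ← mgf_card_filter_mem_setBernoulli (cutPairs_subset_compl_diagSet S)]
  congr 1
  ext s
  rw [Function.comp_apply, card_interedges_compl_fromEdgeSet]

open scoped Classical in
theorem mgf_card_interedges_compl_le :
    mgf (fun G : SimpleGraph V => ((G.interedges S Sᶜ).card : ℝ)) (binomialRandom V p) t ≤
      Real.exp (p * (Real.exp t - 1) * (S.card * Sᶜ.card)) := by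
  have hbase : 0 ≤ 1 - p + p * Real.exp t :=
    add_nonneg (sub_nonneg.2 p.2.2) (mul_nonneg p.2.1 (Real.exp_pos t).le)
  rw [mgf_card_interedges_compl, mul_comm _ ((_ : ℝ) * _), ← Nat.cast_mul, Real.exp_nat_mul]
  gcongr
  linarith [Real.add_one_le_exp (p * (Real.exp t - 1))]

open scoped Classical in
theorem binomialRandom_real_card_interedges_le_le (ht : t ≤ 0) (b : ℝ) :
    (binomialRandom V p).real {G | ((G.interedges S Sᶜ).card : ℝ) ≤ b} ≤
      Real.exp (p * (Real.exp t - 1) * (S.card * Sᶜ.card) - t * b) := by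
  refine (measure_le_le_exp_mul_mgf b ht .of_finite).trans ?_
  rw [sub_eq_neg_add, Real.exp_add, neg_mul]
  gcongr
  exact mgf_card_interedges_compl_le p S

open scoped Classical in
theorem binomialRandom_real_le_card_interedges_le (ht : 0 ≤ t) (b : ℝ) :
    (binomialRandom V p).real {G | b ≤ ((G.interedges S Sᶜ).card : ℝ)} ≤
      Real.exp (p * (Real.exp t - 1) * (S.card * Sᶜ.card) - t * b) := by
  refine (measure_ge_le_exp_mul_mgf b ht .of_finite).trans ?_
  rw [sub_eq_neg_add, Real.exp_add, neg_mul]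
  gcongr
  exact mgf_card_interedges_compl_le p S

theorem card_interedges_singleton_compl (G : SimpleGraph V) [DecidableRel G.Adj] (v : V) :
    (G.interedges {v} {v}ᶜ).card = G.degree v := by
  rw [interedges_def, Finset.singleton_product, Finset.filter_map, Finset.card_map,
    ← card_neighborFinset_eq_degree]
  congr 1
  ext w
  simpa using fun h : G.Adj v w => h.ne'

omit [DecidableEq V] in
open scoped Classical in
theorem binomialRandom_real_le_degree_le (v : V) (b : ℝ) :
    (binomialRandom V p).real {G | b ≤ G.degree v} ≤ Real.exp (2 * (Fintype.card V * p) - b) := by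
  classical
  simp only [← card_interedges_singleton_compl]
  refine (binomialRandom_real_le_card_interedges_le p {v} zero_le_one b).trans ?_
  rw [Finset.card_singleton, Nat.cast_one, one_mul, one_mul]
  gcongr Real.exp (?_ - b)
  have hcard : (({v}ᶜ : Finset V).card : ℝ) ≤ Fintype.card V :=
    Nat.cast_le.2 (Finset.card_le_univ _)
  calc p * (Real.exp 1 - 1) * ({v}ᶜ : Finset V).card ≤ p * 2 * Fintype.card V := by
        gcongr
        · exact mul_nonneg p.2.1 zero_le_two
        · exact p.2.1
        · linarith [Real.exp_one_lt_three]
    _ = 2 * (Fintype.card V * p) := by ring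

omit [DecidableEq V] in
open scoped Classical in
theorem binomialRandom_real_not_forall_degree_le_le (b : ℝ) :
    (binomialRandom V p).real {G | ¬ ∀ v, (G.degree v : ℝ) ≤ b} ≤
      Fintype.card V * Real.exp (2 * (Fintype.card V * p) - b) := by
  calc (binomialRandom V p).real {G | ¬ ∀ v, (G.degree v : ℝ) ≤ b}
      ≤ (binomialRandom V p).real (⋃ v, {G | b ≤ G.degree v}) := by
        refine measureReal_mono fun G hG => ?_
        obtain ⟨v, hv⟩ := not_forall.1 hG
        exact Set.mem_iUnion.2 ⟨v, (not_le.1 hv).le⟩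
    _ ≤ ∑ v : V, (binomialRandom V p).real {G | b ≤ G.degree v} := measureReal_iUnion_fintype_le _
    _ ≤ ∑ _v : V, Real.exp (2 * (Fintype.card V * p) - b) :=
        Finset.sum_le_sum fun v _ => binomialRandom_real_le_degree_le p v b
    _ = Fintype.card V * Real.exp (2 * (Fintype.card V * p) - b) := by
        rw [Finset.sum_const, Finset.card_univ, nsmul_eq_mul]

end RandomGraph

section EdgeExpansion

open SimpleGraph

/-- The edge expansion of `G(n, p)` that the Chernoff bound gives, in units of `n * p`. The value is
chosen so that the lower tail bound with parameter `t = log a` at the level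
`edgeExpansionRate a * x` picks up exactly the factor `exp (a * x)`. -/
noncomputable def edgeExpansionRate (a : ℝ) : ℝ := a / -Real.log a

variable {a : ℝ}

theorem edgeExpansionRate_pos (ha : 0 < a) (ha' : a < 1) : 0 < edgeExpansionRate a :=
  div_pos ha (neg_pos.2 (Real.log_neg ha ha'))

theorem log_mul_edgeExpansionRate (ha : 0 < a) (ha' : a < 1) :
    Real.log a * edgeExpansionRate a = -a := by
  rw [edgeExpansionRate, div_neg, mul_neg, mul_div_cancel₀ _ (Real.log_neg ha ha').ne]

variable {V : Type*} [Fintype V] [DecidableEq V] {p : unitInterval}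

open scoped Classical in
theorem binomialRandom_real_card_interedges_le_edgeExpansionRate_mul (ha : 0 < a) (ha' : a < 1)
    (S : Finset V) :
    (binomialRandom V p).real {G | ((G.interedges S Sᶜ).card : ℝ) ≤
        edgeExpansionRate a * (Fintype.card V * p) * S.card} ≤
      Real.exp (-(p * S.card * ((1 - a) * Sᶜ.card - a * Fintype.card V))) := by
  refine (binomialRandom_real_card_interedges_le_le p S (Real.log_neg ha ha').le _).trans_eq ?_
  rw [Real.exp_log ha]
  congr 1
  linear_combination (-(Fintype.card V * p * S.card) : ℝ) * log_mul_edgeExpansionRate ha ha'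

theorem exp_le_rpow_pow {N : ℕ} (hN : N ≠ 0) {x s : ℝ} {k : ℕ} (hx : x ≤ s * Real.log N * k) :
    Real.exp x ≤ ((N : ℝ) ^ s) ^ k := by
  rw [Real.rpow_def_of_pos (by positivity), ← Real.exp_nat_mul]
  gcongr
  linarith

theorem cast_card_compl_eq_sub (S : Finset V) : (Sᶜ.card : ℝ) = Fintype.card V - S.card := by
  rw [Finset.card_compl, Nat.cast_sub (Finset.card_le_univ S)]

section

variable [Nonempty V] {S : Finset V}

open scoped Classical in
theorem binomialRandom_real_card_interedges_le_of_card_le (ha : 0 < a) (ha' : a ≤ 1 / 4)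
    (hp : Real.log (Fintype.card V) ≤ (1 - 4 * a) * (Fintype.card V * p))
    (hS : S.card ≤ a * Fintype.card V) :
    (binomialRandom V p).real {G | ((G.interedges S Sᶜ).card : ℝ) ≤
        edgeExpansionRate a * (Fintype.card V * p) * S.card} ≤
      ((Fintype.card V : ℝ) ^ (-(1 + a))) ^ S.card := by
  refine (binomialRandom_real_card_interedges_le_edgeExpansionRate_mul ha (by linarith) S).trans
    (exp_le_rpow_pow Fintype.card_ne_zero ?_)
  have hp0 : 0 ≤ (p : ℝ) := p.2.1
  rw [neg_mul, neg_mul, neg_le_neg_iff, cast_card_compl_eq_sub]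
  set N : ℝ := (Fintype.card V : ℝ)
  set k : ℝ := (S.card : ℝ)
  calc (1 + a) * Real.log N * k
      ≤ (1 + a) * ((1 - 4 * a) * (N * p)) * k := by gcongr
    _ ≤ (1 - 3 * a + a ^ 2) * (N * p) * k := by
        rw [← mul_assoc]
        gcongr
        nlinarith
    _ = p * k * ((1 - a) * (N - a * N) - a * N) := by ring
    _ ≤ p * k * ((1 - a) * (N - k) - a * N) := by
        gcongr
        linarith

open scoped Classical in
theorem binomialRandom_real_card_interedges_le_of_le_card (ha : 0 < a) (ha' : a ≤ 1 / 4)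
    (hp : Real.log (Fintype.card V) ≤ Fintype.card V * p)
    (hS : a * Fintype.card V ≤ S.card) (hS' : 2 * S.card ≤ Fintype.card V) :
    (binomialRandom V p).real {G | ((G.interedges S Sᶜ).card : ℝ) ≤
        edgeExpansionRate a * (Fintype.card V * p) * S.card} ≤
      ((Fintype.card V : ℝ) ^ (-(a / 8))) ^ Fintype.card V := by
  refine (binomialRandom_real_card_interedges_le_edgeExpansionRate_mul ha (by linarith) S).trans
    (exp_le_rpow_pow Fintype.card_ne_zero ?_)
  have hp0 : 0 ≤ (p : ℝ) := p.2.1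
  have hhalf : 2 * (S.card : ℝ) ≤ Fintype.card V := by exact_mod_cast hS'
  rw [neg_mul, neg_mul, neg_le_neg_iff, cast_card_compl_eq_sub]
  set N : ℝ := (Fintype.card V : ℝ)
  set k : ℝ := (S.card : ℝ)
  calc a / 8 * Real.log N * N
      ≤ a / 8 * (N * p) * N := by gcongr
    _ = p * (a * N) * (N / 8) := by ring
    _ ≤ p * k * (N / 8) := by gcongr
    _ ≤ p * k * ((1 - a) * (N / 2) - a * N) := by
        gcongr
        nlinarith
    _ ≤ p * k * ((1 - a) * (N - k) - a * N) := by
        gcongr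
        · linarith
        · linarith

end

theorem sum_erase_empty_pow_card (q : ℝ) :
    ∑ S ∈ Finset.univ.erase (∅ : Finset V), q ^ S.card = (1 + q) ^ Fintype.card V - 1 := by
  have hbinomial := Fintype.sum_pow_mul_eq_add_pow V q 1
  simp only [one_pow, mul_one] at hbinomial
  rw [Finset.sum_erase_eq_sub (Finset.mem_univ _), hbinomial, Finset.card_empty, pow_zero, add_comm]

open scoped Classical in
theorem binomialRandom_real_not_hasEdgeExpansion_le_sum (h : ℝ) :
    (binomialRandom V p).real {G | ¬ HasEdgeExpansion G h} ≤
      ∑ S ∈ Finset.univ.erase (∅ : Finset V) with 2 * S.card ≤ Fintype.card V,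
        (binomialRandom V p).real {G | ((G.interedges S Sᶜ).card : ℝ) ≤ h * S.card} := by
  refine (measureReal_mono (fun G hG => ?_) (measure_ne_top _ _)).trans
    (measureReal_biUnion_finset_le _ _)
  obtain ⟨S, hS, hcut⟩ : ∃ S : Finset V, 2 * S.card ≤ Fintype.card V ∧
      (G.interedges S Sᶜ).card < h * S.card := by
    simpa [HasEdgeExpansion] using hG
  have hne : S ≠ ∅ := by
    rintro rfl
    simp at hcut
  exact Set.mem_biUnion (by simp [hne, hS]) hcut.le

open scoped Classical in
theorem binomialRandom_real_not_hasEdgeExpansion_le [Nonempty V] (ha : 0 < a) (ha' : a ≤ 1 / 4)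
    (hp : Real.log (Fintype.card V) ≤ (1 - 4 * a) * (Fintype.card V * p)) :
    (binomialRandom V p).real
        {G | ¬ HasEdgeExpansion G (edgeExpansionRate a * (Fintype.card V * p))} ≤
      (Real.exp ((Fintype.card V : ℝ) ^ (-a)) - 1) +
        (2 * (Fintype.card V : ℝ) ^ (-(a / 8))) ^ Fintype.card V := by
  have hp' : Real.log (Fintype.card V) ≤ Fintype.card V * p :=
    hp.trans (mul_le_of_le_one_left (mul_nonneg (Nat.cast_nonneg _) p.2.1) (by linarith))
  set N := Fintype.card V
  set q : ℝ := (N : ℝ) ^ (-(1 + a))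
  set r : ℝ := (N : ℝ) ^ (-(a / 8))
  have hN : (0 : ℝ) < N := Nat.cast_pos.2 Fintype.card_pos
  have hNq : N * q = (N : ℝ) ^ (-a) := by
    rw [← Real.rpow_one_add' hN.le (by linarith)]
    congr 1
    ring
  calc (binomialRandom V p).real {G | ¬ HasEdgeExpansion G (edgeExpansionRate a * (N * p))}
      ≤ ∑ S ∈ Finset.univ.erase (∅ : Finset V) with 2 * S.card ≤ N, (q ^ S.card + r ^ N) := by
        refine (binomialRandom_real_not_hasEdgeExpansion_le_sum _).trans
          (Finset.sum_le_sum fun S hS => ?_)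
        rcases le_total (S.card : ℝ) (a * N) with hsmall | hlarge
        · exact le_add_of_le_of_nonneg
            (binomialRandom_real_card_interedges_le_of_card_le ha ha' hp hsmall) (by positivity)
        · exact le_add_of_nonneg_of_le (by positivity)
            (binomialRandom_real_card_interedges_le_of_le_card ha ha' hp' hlarge
              (Finset.mem_filter.1 hS).2)
    _ ≤ ∑ S ∈ Finset.univ.erase (∅ : Finset V), q ^ S.card + ∑ _S : Finset V, r ^ N := by
        rw [Finset.sum_add_distrib]
        gcongr
        · exact Finset.filter_subset _ _
        · exact Finset.subset_univ _
    _ = ((1 + q) ^ N - 1) + (2 * r) ^ N := by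
        rw [sum_erase_empty_pow_card, Finset.sum_const, Finset.card_univ, Fintype.card_finset,
          nsmul_eq_mul, Nat.cast_pow, Nat.cast_two, mul_pow]
    _ ≤ (Real.exp ((N : ℝ) ^ (-a)) - 1) + (2 * r) ^ N := by
        rw [← hNq, Real.exp_nat_mul]
        gcongr
        linarith [Real.add_one_le_exp q]

end EdgeExpansion

section Asymptotics

open SimpleGraph

namespace AsymptoticallyAlmostSurely

variable {p : ℕ → unitInterval} {P Q : ∀ n : ℕ, SimpleGraph (Fin n) → Prop}

theorem iff_tendsto_real_not : AsymptoticallyAlmostSurely p P ↔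
    Tendsto (fun n => (binomialRandom (Fin n) (p n)).real {G | ¬ P n G}) atTop (𝓝 0) := by
  have hcompl (n : ℕ) : (binomialRandom (Fin n) (p n)).real {G | ¬ P n G} =
      1 - (binomialRandom (Fin n) (p n)).real {G | P n G} :=
    probReal_compl_eq_one_sub (Set.toFinite _).measurableSet
  rw [AsymptoticallyAlmostSurely, ← ENNReal.tendsto_toReal_iff (fun _ => measure_ne_top _ _)
    ENNReal.one_ne_top, ENNReal.toReal_one]
  simp only [hcompl, measureReal_def]
  refine ⟨fun h => ?_, fun h => ?_⟩
  · simpa only [sub_self] using h.const_sub 1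
  · simpa only [sub_sub_cancel, sub_zero] using h.const_sub 1

theorem of_real_not_le {b : ℕ → ℝ} (hb : Tendsto b atTop (𝓝 0))
    (hP : ∀ᶠ n in atTop, (binomialRandom (Fin n) (p n)).real {G | ¬ P n G} ≤ b n) :
    AsymptoticallyAlmostSurely p P :=
  iff_tendsto_real_not.2 (squeeze_zero' (.of_forall fun _ => measureReal_nonneg) hP hb)

theorem mono (hP : AsymptoticallyAlmostSurely p P)
    (hPQ : ∀ᶠ n in atTop, ∀ G, P n G → Q n G) : AsymptoticallyAlmostSurely p Q :=
  of_real_not_le (iff_tendsto_real_not.1 hP) <| hPQ.mono fun n h =>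
    measureReal_mono (fun G hQ hPG => hQ (h G hPG))

theorem and (hP : AsymptoticallyAlmostSurely p P) (hQ : AsymptoticallyAlmostSurely p Q) :
    AsymptoticallyAlmostSurely p fun n G => P n G ∧ Q n G := by
  have hsum := (iff_tendsto_real_not.1 hP).add (iff_tendsto_real_not.1 hQ)
  rw [add_zero] at hsum
  refine of_real_not_le hsum (.of_forall fun n => ?_)
  simp only [not_and_or]
  exact measureReal_union_le _ _

end AsymptoticallyAlmostSurely

theorem exists_pos_eventually_log_le_of_limsup_div_lt_one {u : ℕ → ℝ} (hu : ∀ n, 0 ≤ u n)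
    (h : limsup (fun n : ℕ => ENNReal.ofReal (Real.log n) / ENNReal.ofReal (u n)) atTop < 1) :
    ∃ a : ℝ, 0 < a ∧ a ≤ 1 / 4 ∧ ∀ᶠ n : ℕ in atTop, Real.log n ≤ (1 - 4 * a) * u n := by
  obtain ⟨c, hc, hc1⟩ := exists_between h
  lift c to NNReal using (hc1.trans ENNReal.one_lt_top).ne
  have hc1' : (c : ℝ) < 1 := by exact_mod_cast hc1
  refine ⟨(1 - c) / 4, by linarith, by linarith [c.2], ?_⟩
  filter_upwards [eventually_lt_of_limsup_lt hc] with n hn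
  have hle := (ENNReal.div_le_iff_le_mul (.inr ENNReal.coe_ne_top)
    (.inl ENNReal.ofReal_ne_top)).1 hn.le
  rw [← ENNReal.ofReal_coe_nnreal, ← ENNReal.ofReal_mul c.coe_nonneg,
    ENNReal.ofReal_le_ofReal_iff (mul_nonneg c.coe_nonneg (hu n))] at hle
  linarith

variable {a : ℝ}

theorem tendsto_natCast_rpow_neg (ha : 0 < a) :
    Tendsto (fun n : ℕ => (n : ℝ) ^ (-a)) atTop (𝓝 0) :=
  (tendsto_rpow_neg_atTop ha).comp tendsto_natCast_atTop_atTop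

theorem tendsto_pow_self_of_tendsto_zero {u : ℕ → ℝ} (hu : ∀ n, 0 ≤ u n)
    (h : Tendsto u atTop (𝓝 0)) : Tendsto (fun n => u n ^ n) atTop (𝓝 0) := by
  refine squeeze_zero' (.of_forall fun n => pow_nonneg (hu n) n) ?_
    (tendsto_pow_atTop_nhds_zero_of_lt_one one_half_pos.le one_half_lt_one)
  filter_upwards [h.eventually_le_const (one_half_pos (α := ℝ))] with n hn
  exact pow_le_pow_left₀ (hu n) hn n

variable {p : ℕ → unitInterval}

open scoped Classical in
theorem asymptoticallyAlmostSurely_hasEdgeExpansion (ha : 0 < a) (ha' : a ≤ 1 / 4)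
    (hp : ∀ᶠ n : ℕ in atTop, Real.log n ≤ (1 - 4 * a) * (n * p n)) :
    AsymptoticallyAlmostSurely p fun n G =>
      HasEdgeExpansion G (edgeExpansionRate a * (n * p n)) := by
  have hsmall : Tendsto (fun n : ℕ => Real.exp ((n : ℝ) ^ (-a)) - 1) atTop (𝓝 0) := by
    simpa using ((tendsto_natCast_rpow_neg ha).rexp).sub_const 1
  have hlarge : Tendsto (fun n : ℕ => (2 * (n : ℝ) ^ (-(a / 8))) ^ n) atTop (𝓝 0) :=
    tendsto_pow_self_of_tendsto_zero (fun n => by positivity) <| by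
      simpa using (tendsto_natCast_rpow_neg (a := a / 8) (by positivity)).const_mul 2
  have hsum := hsmall.add hlarge
  rw [add_zero] at hsum
  refine .of_real_not_le hsum ?_
  filter_upwards [hp, eventually_ge_atTop 1] with n hlog hn
  have : Nonempty (Fin n) := Fin.pos_iff_nonempty.1 hn
  simpa using binomialRandom_real_not_hasEdgeExpansion_le (V := Fin n) ha ha' (by simpa using hlog)

open scoped Classical in
theorem asymptoticallyAlmostSurely_degree_le
    (hp : ∀ᶠ n : ℕ in atTop, Real.log n ≤ n * p n) :
    AsymptoticallyAlmostSurely p fun n G => ∀ v, (G.degree v : ℝ) ≤ 4 * (n * p n) := by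
  refine .of_real_not_le tendsto_inv_atTop_nhds_zero_nat ?_
  filter_upwards [hp, eventually_ge_atTop 1] with n hlog hn
  have hn' : (0 : ℝ) < n := Nat.cast_pos.2 hn
  calc (binomialRandom (Fin n) (p n)).real {G | ¬ ∀ v, (G.degree v : ℝ) ≤ 4 * (n * p n)}
      ≤ n * Real.exp (2 * (n * p n) - 4 * (n * p n)) := by
        simpa using binomialRandom_real_not_forall_degree_le_le (V := Fin n) (p n) (4 * (n * p n))
    _ ≤ n * Real.exp (-2 * Real.log n) := by
        gcongr
        linarith
    _ = (n : ℝ)⁻¹ := by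
        rw [mul_comm (-2 : ℝ), ← Real.rpow_def_of_pos hn',
          ← Real.rpow_one_add' hn'.le (by norm_num)]
        norm_num [Real.rpow_neg_one]

end Asymptotics

/-- The quotient `ln n / (n p)` is taken in `[0, ∞]`, so that it is `∞` when `n ≥ 2` and `p n = 0`,
and its limit superior needs no boundedness assumption. -/
theorem corollary1 (p : ℕ → unitInterval)
    (hp : limsup (fun n : ℕ => ENNReal.ofReal (Real.log (n : ℝ)) /
      ENNReal.ofReal ((n : ℝ) * (p n : ℝ))) atTop < 1) :
    ∃ γ : ℝ, 0 < γ ∧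
      AsymptoticallyAlmostSurely p
        (fun n G => γ * ((n : ℝ) * (p n : ℝ)) ≤ algebraicConnectivity G) := by
  classical
  have hmean (n : ℕ) : 0 ≤ (n : ℝ) * p n := mul_nonneg n.cast_nonneg (p n).2.1
  obtain ⟨a, ha, ha', hlog⟩ := exists_pos_eventually_log_le_of_limsup_div_lt_one hmean hp
  have hlog' : ∀ᶠ n : ℕ in atTop, Real.log n ≤ n * p n :=
    hlog.mono fun n h => h.trans (mul_le_of_le_one_left (hmean n) (by linarith))
  have hrate : 0 < edgeExpansionRate a := edgeExpansionRate_pos ha (by linarith)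
  refine ⟨edgeExpansionRate a ^ 2 / 8, by positivity,
    ((asymptoticallyAlmostSurely_hasEdgeExpansion ha ha' hlog).and
      (asymptoticallyAlmostSurely_degree_le hlog')).mono ?_⟩
  filter_upwards [hlog', eventually_ge_atTop 2] with n hn hn2 G ⟨hexpansion, hdegree⟩
  have hpos : 0 < (n : ℝ) * p n := (Real.log_pos (by exact_mod_cast hn2)).trans_le hn
  calc edgeExpansionRate a ^ 2 / 8 * (n * p n)
      = (edgeExpansionRate a * (n * p n)) ^ 2 / (2 * (4 * (n * p n))) := by
        field_simp
        ring
    _ ≤ algebraicConnectivity G :=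
        hexpansion.le_algebraicConnectivity (by simpa using hn2) (by positivity) (by positivity)
          hdegree
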